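/- Consider a linear program in standard form, $\min c^\top x$ s.t. $Ax=b$, $x\ge 0$, with $A\in\mathbb R^{m\times n}$, $A\neq 0$, $b\in\mathbb R^m$, $c\in\mathbb R^n$, and let $\mathcal Z^*\subset\mathbb R^n\times\mathbb R^m$ be its set of primal-dual optimal solutions, i.e. the set of saddle points of $L(x,y)=c^\top x-y^\top Ax+b^\top y$ over $x\ge 0$, $y\in\mathbb R^m$ (minimum in $x$, maximum in $y$). Assume $\mathcal Z^*\neq\emptyset$. For $z=(x,y)$ let the KKT error be $$\mathrm{KKT}(z)=\left\|\bigl(Ax-b,\ [-x]^+,\ [A^\top y-c]^+,\ [c^\top x-b^\top y]^+\bigr)\right\|_2,$$ where $[\cdot]^+$ is the componentwise positive part. Call $\alpha>0$ a sharpness constant if $\alpha\,\mathrm{dist}_2(z,\mathcal Z^*)\le \mathrm{KKT}(z)$ for all $z$. Fix a step size $0<s\le \frac1{2\|A\|_2}$, a factor $\beta\in(0,1)$ and an arbitrary initial point $z^{0,0}=(x^{0,0},y^{0,0})\in\mathbb R^n\times\mathbb R^m$. Restarted PDHG produces, in the $n$-th outer iteration and for $k=0,1,2,\dots$, $$x^{n,k+1}=\mathrm{proj}_{\mathbb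 R^n_+}\bigl(x^{n,k}-s(c-A^\top y^{n,k})\bigr),\qquad y^{n,k+1}=y^{n,k}+s\bigl(b-A(2x^{n,k+1}-x^{n,k})\bigr),$$ with the averages $\bar z^{n,k}=\frac1k\sum_{i=1}^k z^{n,i}$. The restart length $\tau^n$ is the first $k\ge 1$ with $\mathrm{KKT}(\bar z^{n,k})\le\beta\,\mathrm{KKT}(z^{n,0})$, and the next outer iteration starts from $z^{n+1,0}=\bar z^{n,\tau^n}$. Write $\|v\|_{P_s}^2=\langle v,P_sv\rangle$ with $P_s=\begin{pmatrix}I&sA^\top\\ sA&I\end{pmatrix}$. Then every inner loop terminates (so $\tau^n$ is well defined for all $n$), a sharpness constant exists, and the following hold. (i) There is $R>0$ with $\|z^{n,k}\|_2\le R$ for all $n,k$; more precisely, $\|z^{n,k}\|_2\le\sqrt2\,\|z^{0,0}-z^*\|_{P_s}+\|z^*\|_2$ for every $z^*\in\mathcal Z^*$ and all $n,k$. (ii) For every sharpness constant $\alpha$, every $R$ with $\|z^{n,k}\|_2\le R$ for all $n$ and $0\le k\le\tau^n$, and every $n$, $$\tau^n\le\frac{8\sqrt2\,\sqrt{1+R^2}}{\alpha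 s\beta}.$$ (iii) For every sharpness constant $\alpha$ and every $n$, $$\mathrm{dist}_2(z^{n,0},\mathcal Z^*)\le\beta^n\,\frac1\alpha\,\mathrm{KKT}(z^{0,0}).$$ Consequently, the scheme has iteration complexity $\widetilde O\bigl(\frac{\|A\|_2}{\alpha}\log\frac1\varepsilon\bigr)$: if $s=C/\|A\|_2$ (so $0<C\le\frac12$), then for $\alpha$, $R$ as in (ii) and every $\varepsilon>0$ there is an $N$ such that $\mathrm{dist}_2(z^{N,0},\mathcal Z^*)\le\varepsilon$ and the total number of PDHG steps satisfies $$\sum_{j<N}\tau^j\le\frac{8\sqrt2\,\sqrt{1+R^2}}{C\beta}\cdot\frac{\|A\|_2}{\alpha}\cdot\max\left\{0,\left\lceil\frac{\log\bigl(\mathrm{KKT}(z^{0,0})/(\alpha\varepsilon)\bigr)}{\log(1/\beta)}\right\rceil\right\};$$ likewise there is an $N$ with $\mathrm{KKT}(z^{N,0})\le\varepsilon$ and the same bound on $\sum_{j<N}\tau^j$, with $\mathrm{KKT}(z^{0,0})/\varepsilon$ in place of $\mathrm{KKT}(z^{0,0})/(\alpha\varepsilon)$. (If $\mathrm{KKT}(z^{0,0})=0$,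 the maximum is read as $0$.) -/

import Mathlib

open scoped Matrix.Norms.L2Operator

/-- The data of a linear program in standard form, `min cᵀx  s.t.  A x = b, x ≥ 0`,
with `n` variables and `m` equality constraints. -/
structure StdLP (m n : ℕ) where
  A : Matrix (Fin m) (Fin n) ℝ
  b : EuclideanSpace ℝ (Fin m)
  c : EuclideanSpace ℝ (Fin n)

/-- Primal-dual pairs `z = (x, y)` with the Euclidean norm of `ℝⁿ⁺ᵐ`. -/
abbrev PDPair (m n : ℕ) : Type :=
  WithLp 2 (EuclideanSpace ℝ (Fin n) × EuclideanSpace ℝ (Fin m))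

/-- The pair `(x, y)`. -/
def mkPair {m n : ℕ} (x : EuclideanSpace ℝ (Fin n)) (y : EuclideanSpace ℝ (Fin m)) :
    PDPair m n :=
  WithLp.toLp 2 (x, y)

/-- The componentwise positive part `[v]⁺`; it is also the Euclidean projection of `v` onto the
nonnegative orthant. -/
noncomputable def vecPos {d : ℕ} (v : EuclideanSpace ℝ (Fin d)) : EuclideanSpace ℝ (Fin d) :=
  WithLp.toLp 2 (fun i => max (v i) 0)

namespace StdLP

variable {m n : ℕ}

/-- `x ↦ A x`. -/
noncomputable def mulA (P : StdLP m n) (x : EuclideanSpace ℝ (Fin n)) :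
    EuclideanSpace ℝ (Fin m) :=
  Matrix.toEuclideanLin P.A x

/-- `y ↦ Aᵀ y`. -/
noncomputable def mulAT (P : StdLP m n) (y : EuclideanSpace ℝ (Fin m)) :
    EuclideanSpace ℝ (Fin n) :=
  Matrix.toEuclideanLin P.A.transpose y

/-- The Lagrangian `L(x, y) = cᵀx - yᵀA x + bᵀy`. -/
noncomputable def lagrangian (P : StdLP m n)
    (x : EuclideanSpace ℝ (Fin n)) (y : EuclideanSpace ℝ (Fin m)) : ℝ :=
  inner ℝ P.c x - inner ℝ y (P.mulA x) + inner ℝ P.b y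

/-- The set `Z*` of primal-dual optimal solutions: the saddle points of the problem
`min_{x ≥ 0} max_y L(x, y)`. -/
def optSet (P : StdLP m n) : Set (PDPair m n) :=
  {z | (∀ i, 0 ≤ z.fst i) ∧
    (∀ y : EuclideanSpace ℝ (Fin m), P.lagrangian z.fst y ≤ P.lagrangian z.fst z.snd) ∧
    (∀ x : EuclideanSpace ℝ (Fin n), (∀ i, 0 ≤ x i) →
      P.lagrangian z.fst z.snd ≤ P.lagrangian x z.snd)}

/-- The KKT error: the Euclidean norm of the stacked vector
`(A x - b, [-x]⁺, [Aᵀy - c]⁺, [cᵀx - bᵀy]⁺)`. -/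
noncomputable def kkt (P : StdLP m n) (z : PDPair m n) : ℝ :=
  Real.sqrt (‖P.mulA z.fst - P.b‖ ^ 2 + ‖vecPos (-z.fst)‖ ^ 2
    + ‖vecPos (P.mulAT z.snd - P.c)‖ ^ 2
    + (max (inner ℝ P.c z.fst - inner ℝ P.b z.snd) 0) ^ 2)

/-- `α` is a sharpness constant of the KKT error: `α > 0` and `α · dist₂(z, Z*) ≤ KKT(z)` for
all `z`. -/
def IsSharpnessConst (P : StdLP m n) (α : ℝ) : Prop :=
  0 < α ∧ ∀ z : PDPair m n, α * Metric.infDist z P.optSet ≤ P.kkt z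

/-- The norm `‖v‖_{P_s} = √⟨v, P_s v⟩` with `P_s = [[I, s Aᵀ], [s A, I]]`. -/
noncomputable def psNorm (P : StdLP m n) (s : ℝ) (v : PDPair m n) : ℝ :=
  Real.sqrt (inner ℝ v (mkPair (v.fst + s • P.mulAT v.snd) (s • P.mulA v.fst + v.snd)))

/-- One PDHG step with primal and dual step size `s`:
`x' = proj_{ℝⁿ₊}(x - s (c - Aᵀy))`, `y' = y + s (b - A (2x' - x))`. -/
noncomputable def pdhgStep (P : StdLP m n) (s : ℝ) (z : PDPair m n) : PDPair m n :=
  let x' := vecPos (z.fst - s • (P.c - P.mulAT z.snd))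
  mkPair x' (z.snd + s • (P.b - P.mulA ((2 : ℝ) • x' - z.fst)))

/-- The `k`-th inner PDHG iterate started from `z`. -/
noncomputable def inner_iter (P : StdLP m n) (s : ℝ) (z : PDPair m n) : ℕ → PDPair m n
  | 0 => z
  | k + 1 => P.pdhgStep s (inner_iter P s z k)

/-- The running average of the inner iterates started from `z`,
`z̄^{k+1} = k/(k+1) · z̄^k + 1/(k+1) · z^{k+1}` (the value at `0` has weight `0`). -/
noncomputable def inner_avg (P : StdLP m n) (s : ℝ) (z : PDPair m n) : ℕ → PDPair m n
  | 0 => z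
  | k + 1 => ((k : ℝ) / ((k : ℝ) + 1)) • inner_avg P s z k
      + ((1 : ℝ) / ((k : ℝ) + 1)) • P.inner_iter s z (k + 1)

/-- The restart test at inner iteration `k ≥ 1`, for an inner loop started from `z`. -/
def RestartTest (P : StdLP m n) (s β : ℝ) (z : PDPair m n) (k : ℕ) : Prop :=
  1 ≤ k ∧ P.kkt (P.inner_avg s z k) ≤ β * P.kkt z

/-- The restart length of the inner loop started from `z`: the first `k ≥ 1` passing the restart
test (meaningful only when the inner loop terminates). -/
noncomputable def restartLength (P : StdLP m n) (s β : ℝ) (z : PDPair m n) : ℕ :=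
  sInf {k | P.RestartTest s β z k}

/-- The outer iterates `z^{N,0}` of restarted PDHG from the initial point `z0`: each inner loop is
restarted from the average that first passes the restart test. -/
noncomputable def outer (P : StdLP m n) (s β : ℝ) (z0 : PDPair m n) : ℕ → PDPair m n
  | 0 => z0
  | N + 1 => P.inner_avg s (outer P s β z0 N) (P.restartLength s β (outer P s β z0 N))

/-- The iterate `z^{N,k}` of restarted PDHG. -/
noncomputable def iterate (P : StdLP m n) (s β : ℝ) (z0 : PDPair m n) (N k : ℕ) : PDPair m n :=
  P.inner_iter s (P.outer s β z0 N) k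

/-- The restart length `τ^N`, i.e. the number of PDHG steps of the `N`-th inner loop. -/
noncomputable def tau (P : StdLP m n) (s β : ℝ) (z0 : PDPair m n) (N : ℕ) : ℕ :=
  P.restartLength s β (P.outer s β z0 N)

end StdLP

/-!
The proof rests on three facts.

*Hoffman's bound* (`exists_infDist_le_mul_sum_violation`). The optimal set is the polyhedron of
primal and dual feasible pairs without duality gap (`mem_optSet_iff`), and the distance to a
polyhedron is at most a constant times the constraint violation; this gives a sharpness constant.
The bound is proved by compactness: if `p` is the projection of `z`, then `z - p` lies in the polar
of the cone of the constraints active at `p`, and on the unit vectors of that polar the sum of the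
positive parts of the active functionals is bounded below.

*PDHG as a proximal point method.* A step `z ↦ z'` solves `0 ∈ s F(z') + P_s (z' - z)` for the
monotone operator `F` of the saddle point problem. Hence it does not increase the `P_s`-distance to
an optimal solution (`inner_psOp_pdhgStep_sub_le`), which bounds all iterates, as `s ‖A‖ ≤ 1/2`
makes `P_s` comparable to the identity. Summing the inclusion over an inner loop, the residuals of
the average telescope to `P_s (z^k - z^0) / (s k)` and its duality gap to
`(‖z^0‖² - ‖z^k‖²) / (2 s k)` in the norm of `P_s`, so the KKT error of the average is at most
`5 √(1 + R²) dist(z^0, Z*) / (s k)` (`kkt_inner_avg_le`). By sharpness the restart test holds once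
`k ≥ 5 √(1 + R²) / (α s β)`, so a restart length `τ ≥ 2` is at most twice this number.

*Sharpness constants satisfy `α ≤ ‖A‖`* (`IsSharpnessConst.le_norm`). This covers `τ = 1`, where the
claimed bound requires `α s` not to be large.

The KKT error shrinks by the factor `β` at each restart, and the linear rate and the total iteration
count follow.
-/

/-! ### The Hoffman bound -/

/-- A vector in the polar of the polyhedral cone `{d | ∀ j ∈ J, g j d ≤ 0}` is controlled by the
positive parts of the `g j`. These cannot all vanish at a unit vector `v` of the polar: `v` would
then lie in the cone, hence `⟪v, v⟫ ≤ 0`; compactness of the unit sphere does the rest. -/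
theorem exists_norm_le_mul_sum_pos_of_polar {E ι : Type*} [NormedAddCommGroup E]
    [InnerProductSpace ℝ E] [FiniteDimensional ℝ E] (g : ι → E →ₗ[ℝ] ℝ) (J : Finset ι) :
    ∃ C : ℝ, 0 ≤ C ∧ ∀ v : E, (∀ d : E, (∀ j ∈ J, g j d ≤ 0) → inner ℝ v d ≤ 0) →
      ‖v‖ ≤ C * ∑ j ∈ J, max (g j v) 0 := by
  set N : Set E := {v | ∀ d : E, (∀ j ∈ J, g j d ≤ 0) → inner ℝ v d ≤ 0} with hN
  have hNc : IsClosed N := by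
    simp only [hN, Set.ofPred_forall]
    exact isClosed_iInter fun d => isClosed_iInter fun _ =>
      isClosed_le (by fun_prop) continuous_const
  have hK : IsCompact (N ∩ Metric.sphere 0 1) := (isCompact_sphere 0 1).inter_left hNc
  set f : E → ℝ := fun v => ∑ j ∈ J, max (g j v) 0 with hf
  have hfc : Continuous f := continuous_finsetSum _ fun j _ =>
    ((g j).continuous_of_finiteDimensional).max continuous_const
  have hfpos : ∀ v ∈ N ∩ Metric.sphere (0 : E) 1, 0 < f v := by
    rintro v ⟨hvN, hv1⟩
    have h0 : 0 ≤ f v := Finset.sum_nonneg fun j _ => le_max_right _ _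
    refine lt_of_le_of_ne h0 fun h => ?_
    have hz := (Finset.sum_eq_zero_iff_of_nonneg (fun j _ => le_max_right (g j v) 0)).1 h.symm
    have hvv := hvN v fun j hj => max_eq_right_iff.1 (hz j hj)
    rw [real_inner_self_eq_norm_sq, mem_sphere_zero_iff_norm.1 hv1] at hvv
    norm_num at hvv
  obtain ⟨ε, hε, hεf⟩ : ∃ ε : ℝ, 0 < ε ∧ ∀ v ∈ N ∩ Metric.sphere (0 : E) 1, ε ≤ f v := by
    rcases (N ∩ Metric.sphere (0 : E) 1).eq_empty_or_nonempty with h | h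
    · exact ⟨1, one_pos, by simp [h]⟩
    · obtain ⟨v, hv, hmin⟩ := hK.exists_isMinOn h hfc.continuousOn
      exact ⟨f v, hfpos v hv, fun w hw => hmin hw⟩
  refine ⟨1 / ε, by positivity, fun v hv => ?_⟩
  rcases eq_or_ne v 0 with rfl | hv0
  · simp
  have hn : 0 < ‖v‖ := norm_pos_iff.2 hv0
  have hmem : ‖v‖⁻¹ • v ∈ N ∩ Metric.sphere (0 : E) 1 := by
    refine ⟨fun d hd => ?_, ?_⟩
    · rw [real_inner_smul_left]
      exact mul_nonpos_of_nonneg_of_nonpos (by positivity) (hv d hd)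
    · simp [norm_smul, hn.ne']
  have h1 := hεf _ hmem
  have h2 : f (‖v‖⁻¹ • v) = ‖v‖⁻¹ * f v := by
    simp only [hf, map_smul, smul_eq_mul, Finset.mul_sum]
    refine Finset.sum_congr rfl fun j _ => ?_
    rw [mul_max_of_nonneg _ _ (by positivity), mul_zero]
  rw [h2, ← div_eq_inv_mul, le_div_iff₀ hn] at h1
  rw [one_div, ← div_eq_inv_mul, le_div_iff₀ hε]
  linarith

/-- Hoffman's error bound: the distance to a nonempty polyhedron is at most a constant times the
total constraint violation. For the projection `p` of `z`, the vector `z - p` lies in the polar of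
the cone cut out by the constraints active at `p`, on which the violations at `z` are the values
`g j (z - p)`; there are finitely many possible active sets. -/
theorem exists_infDist_le_mul_sum_violation {E ι : Type*} [NormedAddCommGroup E]
    [InnerProductSpace ℝ E] [FiniteDimensional ℝ E] [Fintype ι] (g : ι → E →ₗ[ℝ] ℝ) (h : ι → ℝ)
    (hne : {z | ∀ i, g i z ≤ h i}.Nonempty) :
    ∃ C : ℝ, 0 < C ∧ ∀ z : E,
      Metric.infDist z {z | ∀ i, g i z ≤ h i} ≤ C * ∑ i, max (g i z - h i) 0 := by
  classical
  choose C hC0 hC using exists_norm_le_mul_sum_pos_of_polar g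
  set S : Set E := {z | ∀ i, g i z ≤ h i} with hS
  have hcont : ∀ i, Continuous (g i) := fun i => (g i).continuous_of_finiteDimensional
  have hSc : IsClosed S := by
    simp only [hS, Set.ofPred_forall]
    exact isClosed_iInter fun i => isClosed_le (hcont i) continuous_const
  have hSconv : Convex ℝ S := by
    simp only [hS, Set.ofPred_forall]
    exact convex_iInter fun i => convex_halfSpace_le (g i).isLinear (h i)
  refine ⟨1 + ∑ J : Finset ι, C J,
    add_pos_of_pos_of_nonneg one_pos (Finset.sum_nonneg fun J _ => hC0 J), fun z => ?_⟩
  obtain ⟨p, hpS, hp⟩ := exists_norm_eq_iInf_of_complete_convex hne hSc.isComplete hSconv z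
  have hproj := (norm_eq_iInf_iff_real_inner_le_zero hSconv hpS).1 hp
  set J : Finset ι := Finset.univ.filter fun i => g i p = h i with hJ
  have hpolar : ∀ d : E, (∀ j ∈ J, g j d ≤ 0) → inner ℝ (z - p) d ≤ 0 := by
    intro d hd
    -- a short step from `p` along `d` violates neither the active nor the inactive constraints
    have hev : ∀ᶠ t : ℝ in nhdsWithin 0 (Set.Ioi 0), p + t • d ∈ S := by
      simp only [hS, Set.mem_ofPred_eq]
      rw [Filter.eventually_all]
      intro i
      by_cases hi : g i p = h i
      · filter_upwards [self_mem_nhdsWithin] with t ht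
        have := hd i (by simp [hJ, hi])
        simp only [map_add, map_smul, smul_eq_mul, hi]
        nlinarith [Set.mem_Ioi.1 ht]
      · have hlt : g i p < h i := lt_of_le_of_ne (hpS i) hi
        have ht : Filter.Tendsto (fun t : ℝ => g i (p + t • d)) (nhds 0) (nhds (g i p)) := by
          have : Continuous fun t : ℝ => g i (p + t • d) := (hcont i).comp (by fun_prop)
          simpa using this.tendsto 0
        exact nhdsWithin_le_nhds ((ht.eventually_lt_const hlt).mono fun t h => h.le)
    obtain ⟨t, htS, ht⟩ := (hev.and self_mem_nhdsWithin).exists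
    have h1 := hproj _ htS
    rw [add_sub_cancel_left, real_inner_smul_right] at h1
    exact nonpos_of_mul_nonpos_right h1 ht
  have h1 := hC J (z - p) hpolar
  have h2 : ∑ j ∈ J, max (g j (z - p)) 0 ≤ ∑ i, max (g i z - h i) 0 := by
    rw [Finset.sum_congr rfl fun j hj => by
      rw [map_sub, (Finset.mem_filter.1 hj).2]]
    exact Finset.sum_le_sum_of_subset_of_nonneg (Finset.subset_univ _)
      fun i _ _ => le_max_right _ _
  calc Metric.infDist z S ≤ dist z p := Metric.infDist_le_dist_of_mem hpS
    _ = ‖z - p‖ := dist_eq_norm z p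
    _ ≤ C J * ∑ j ∈ J, max (g j (z - p)) 0 := h1
    _ ≤ (1 + ∑ J : Finset ι, C J) * ∑ i, max (g i z - h i) 0 := by
      have h3 : C J ≤ ∑ J : Finset ι, C J :=
        Finset.single_le_sum (fun J _ => hC0 J) (Finset.mem_univ J)
      exact mul_le_mul (by linarith) h2 (Finset.sum_nonneg fun j _ => le_max_right _ _)
        (add_nonneg zero_le_one (Finset.sum_nonneg fun J _ => hC0 J))

/-! ### Linear algebra of the linear program -/

namespace StdLP

variable {m n : ℕ}

theorem inner_nonneg_of_forall_nonneg {d : ℕ} {u v : EuclideanSpace ℝ (Fin d)}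
    (hu : ∀ i, 0 ≤ u i) (hv : ∀ i, 0 ≤ v i) : 0 ≤ inner ℝ u v := by
  rw [PiLp.inner_apply]
  exact Finset.sum_nonneg fun i _ => by
    simpa using mul_nonneg (hv i) (hu i)

theorem norm_vecPos_le {d : ℕ} {v w : EuclideanSpace ℝ (Fin d)} (h : ∀ i, v i ≤ w i) :
    ‖vecPos v‖ ≤ ‖w‖ := by
  rw [EuclideanSpace.norm_eq, EuclideanSpace.norm_eq]
  refine Real.sqrt_le_sqrt (Finset.sum_le_sum fun i _ => ?_)
  refine pow_le_pow_left₀ (norm_nonneg _) ?_ 2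
  have h1 : ‖vecPos v i‖ = max (v i) 0 := by
    simp [vecPos]
  rw [h1, Real.norm_eq_abs]
  exact max_le ((h i).trans (le_abs_self _)) (abs_nonneg _)

theorem vecPos_eq_zero {d : ℕ} {v : EuclideanSpace ℝ (Fin d)} (h : ∀ i, v i ≤ 0) :
    vecPos v = 0 := by
  ext i
  simp [vecPos, h i]

theorem abs_apply_le_norm {d : ℕ} (v : EuclideanSpace ℝ (Fin d)) (i : Fin d) : |v i| ≤ ‖v‖ := by
  simpa using PiLp.norm_apply_le v i

theorem mulA_add (P : StdLP m n) (x x' : EuclideanSpace ℝ (Fin n)) :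
    P.mulA (x + x') = P.mulA x + P.mulA x' := map_add _ _ _

theorem mulA_sub (P : StdLP m n) (x x' : EuclideanSpace ℝ (Fin n)) :
    P.mulA (x - x') = P.mulA x - P.mulA x' := map_sub _ _ _

theorem mulA_smul (P : StdLP m n) (t : ℝ) (x : EuclideanSpace ℝ (Fin n)) :
    P.mulA (t • x) = t • P.mulA x := map_smul _ _ _

theorem mulAT_add (P : StdLP m n) (y y' : EuclideanSpace ℝ (Fin m)) :
    P.mulAT (y + y') = P.mulAT y + P.mulAT y' := map_add _ _ _

theorem mulAT_sub (P : StdLP m n) (y y' : EuclideanSpace ℝ (Fin m)) :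
    P.mulAT (y - y') = P.mulAT y - P.mulAT y' := map_sub _ _ _

theorem mulAT_smul (P : StdLP m n) (t : ℝ) (y : EuclideanSpace ℝ (Fin m)) :
    P.mulAT (t • y) = t • P.mulAT y := map_smul _ _ _

theorem inner_mulA (P : StdLP m n) (x : EuclideanSpace ℝ (Fin n)) (y : EuclideanSpace ℝ (Fin m)) :
    inner ℝ (P.mulA x) y = inner ℝ x (P.mulAT y) := by
  simp only [mulA, mulAT, EuclideanSpace.inner_eq_star_dotProduct, Matrix.toLpLin_apply,
    star_trivial]
  rw [Matrix.dotProduct_mulVec, ← Matrix.mulVec_transpose]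

theorem norm_mulA_le (P : StdLP m n) (x : EuclideanSpace ℝ (Fin n)) :
    ‖P.mulA x‖ ≤ ‖P.A‖ * ‖x‖ := by
  simpa [mulA, Matrix.toLpLin_apply] using Matrix.l2_opNorm_mulVec P.A x

theorem norm_mulAT_le (P : StdLP m n) (y : EuclideanSpace ℝ (Fin m)) :
    ‖P.mulAT y‖ ≤ ‖P.A‖ * ‖y‖ := by
  have h := Matrix.l2_opNorm_mulVec P.A.transpose y
  rw [← Matrix.conjTranspose_eq_transpose_of_trivial, Matrix.l2_opNorm_conjTranspose,
    Matrix.conjTranspose_eq_transpose_of_trivial] at h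
  simpa [mulAT, Matrix.toLpLin_apply] using h

theorem inner_pair (v w : PDPair m n) :
    inner ℝ v w = inner ℝ v.fst w.fst + inner ℝ v.snd w.snd :=
  WithLp.prod_inner_apply v w

theorem norm_sq_pair (v : PDPair m n) : ‖v‖ ^ 2 = ‖v.fst‖ ^ 2 + ‖v.snd‖ ^ 2 := by
  simp only [← real_inner_self_eq_norm_sq, inner_pair]

theorem norm_snd_le (v : PDPair m n) : ‖v.snd‖ ≤ ‖v‖ :=
  abs_le_of_sq_le_sq' (by nlinarith [norm_sq_pair v, sq_nonneg ‖v.fst‖]) (norm_nonneg v) |>.2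

/-! ### Optimality and the KKT error -/

/-- The saddle points are the pairs of a primal and a dual feasible point without duality gap. -/
theorem mem_optSet_iff (P : StdLP m n) (z : PDPair m n) :
    z ∈ P.optSet ↔ P.mulA z.fst = P.b ∧ (∀ i, 0 ≤ z.fst i) ∧ (∀ i, P.mulAT z.snd i ≤ P.c i) ∧
      inner ℝ P.c z.fst ≤ inner ℝ P.b z.snd := by
  simp only [optSet, Set.mem_ofPred_eq, lagrangian]
  constructor
  · rintro ⟨hx, hy, hmin⟩
    have hb : P.mulA z.fst = P.b := by
      have h := hy (z.snd + (P.b - P.mulA z.fst))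
      rw [inner_add_left, inner_add_right, inner_sub_left, inner_sub_right] at h
      have h2 := real_inner_self_nonneg (x := P.mulA z.fst - P.b)
      have h3 : inner ℝ (P.mulA z.fst - P.b) (P.mulA z.fst - P.b) = 0 := by
        apply le_antisymm _ h2
        rw [inner_sub_left, inner_sub_right, inner_sub_right]
        linarith only [h, real_inner_comm P.b (P.mulA z.fst)]
      exact sub_eq_zero.1 (inner_self_eq_zero.1 h3)
    have hred : ∀ x : EuclideanSpace ℝ (Fin n), (∀ i, 0 ≤ x i) →
        inner ℝ (P.c - P.mulAT z.snd) z.fst ≤ inner ℝ (P.c - P.mulAT z.snd) x := by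
      intro x h0
      have := hmin x h0
      rw [inner_sub_left, inner_sub_left, real_inner_comm z.fst (P.mulAT z.snd),
        real_inner_comm x (P.mulAT z.snd), ← inner_mulA, ← inner_mulA,
        real_inner_comm z.snd, real_inner_comm z.snd]
      linarith
    refine ⟨hb, hx, fun i => ?_, ?_⟩
    · have h := hred (z.fst + EuclideanSpace.single i 1) fun j => by
        have : (0 : ℝ) ≤ EuclideanSpace.single i (1 : ℝ) j := by
          simp only [PiLp.single_apply]; split_ifs <;> norm_num
        exact add_nonneg (hx j) this
      rw [inner_add_right, EuclideanSpace.inner_single_right] at h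
      simp at h
      linarith
    · have h := hred 0 fun i => le_rfl
      rw [inner_zero_right, inner_sub_left, real_inner_comm z.fst (P.mulAT z.snd), ← inner_mulA,
        hb] at h
      linarith
  · rintro ⟨hb, hx, hd, hgap⟩
    refine ⟨hx, fun y => ?_, fun x h0 => ?_⟩
    · rw [hb, real_inner_comm P.b y, real_inner_comm P.b z.snd]; linarith
    · have h1 : 0 ≤ inner ℝ (P.c - P.mulAT z.snd) x :=
        inner_nonneg_of_forall_nonneg (fun i => sub_nonneg.2 (hd i)) h0
      rw [inner_sub_left, real_inner_comm x (P.mulAT z.snd), ← inner_mulA] at h1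
      rw [hb]
      linarith only [h1, hgap, real_inner_comm (P.mulA x) z.snd, real_inner_comm P.b z.snd]

theorem kkt_nonneg (P : StdLP m n) (z : PDPair m n) : 0 ≤ P.kkt z := Real.sqrt_nonneg _

theorem kkt_sq (P : StdLP m n) (z : PDPair m n) :
    P.kkt z ^ 2 = ‖P.mulA z.fst - P.b‖ ^ 2 + ‖vecPos (-z.fst)‖ ^ 2
      + ‖vecPos (P.mulAT z.snd - P.c)‖ ^ 2
      + (max (inner ℝ P.c z.fst - inner ℝ P.b z.snd) 0) ^ 2 :=
  Real.sq_sqrt (by positivity)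

/-- If `x ≥ 0` and a pair `w`, scaled by `t`, dominates the other two feasibility residuals of `z`, and
`t ‖w‖ R` its duality gap, then the KKT error of `z` is at most `t ‖w‖ √(1 + R²)`. -/
theorem kkt_le_of_forall (P : StdLP m n) (z : PDPair m n) {t R : ℝ} (w : PDPair m n)
    (hR : 0 ≤ R) (ht : 0 ≤ t)
    (hx : ∀ i, 0 ≤ z.fst i) (hA : ‖P.mulA z.fst - P.b‖ ≤ t * ‖w.snd‖)
    (hd : ∀ i, P.mulAT z.snd i - P.c i ≤ t * w.fst i)
    (hg : inner ℝ P.c z.fst - inner ℝ P.b z.snd ≤ t * ‖w‖ * R) :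
    P.kkt z ≤ t * ‖w‖ * Real.sqrt (1 + R ^ 2) := by
  refine abs_le_of_sq_le_sq' ?_ (by positivity) |>.2
  rw [kkt_sq, mul_pow, Real.sq_sqrt (by positivity), vecPos_eq_zero (by simpa using hx)]
  have h1 : ‖vecPos (P.mulAT z.snd - P.c)‖ ≤ t * ‖w.fst‖ := by
    have := norm_vecPos_le (v := P.mulAT z.snd - P.c) (w := t • w.fst) (by simpa using hd)
    rwa [norm_smul, Real.norm_of_nonneg ht] at this
  have h2 : max (inner ℝ P.c z.fst - inner ℝ P.b z.snd) 0 ≤ t * ‖w‖ * R :=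
    max_le hg (by positivity)
  have h3 := pow_le_pow_left₀ (norm_nonneg _) hA 2
  have h4 := pow_le_pow_left₀ (norm_nonneg _) h1 2
  have h5 := pow_le_pow_left₀ (le_max_right _ _) h2 2
  have h6 := norm_sq_pair w
  simp only [norm_zero]
  calc _ ≤ (t * ‖w.snd‖) ^ 2 + 0 ^ 2 + (t * ‖w.fst‖) ^ 2 + (t * ‖w‖ * R) ^ 2 := by gcongr
    _ = t ^ 2 * (‖w.fst‖ ^ 2 + ‖w.snd‖ ^ 2) + (t * ‖w‖ * R) ^ 2 := by ring
    _ = _ := by rw [← h6]; ring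

/-- Hoffman's bound for `Z*`, the solution set of `A x ≤ b`, `-A x ≤ -b`, `-x ≤ 0`, `Aᵀ y ≤ c` and
`cᵀ x - bᵀ y ≤ 0`: the violation of each of these inequalities is at most the KKT error. -/
theorem exists_isSharpnessConst (P : StdLP m n) (hopt : P.optSet.Nonempty) :
    ∃ α : ℝ, P.IsSharpnessConst α := by
  let g : (Fin m ⊕ Fin m) ⊕ (Fin n ⊕ Fin n) ⊕ Unit → PDPair m n →ₗ[ℝ] ℝ := fun i =>
    match i with
    | .inl (.inl i) => IsLinearMap.mk' (fun z => P.mulA z.fst i)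
        ⟨fun _ _ => by simp [mulA_add], fun _ _ => by simp [mulA_smul]⟩
    | .inl (.inr i) => IsLinearMap.mk' (fun z => -P.mulA z.fst i)
        ⟨fun _ _ => by simp [mulA_add]; ring, fun _ _ => by simp [mulA_smul]⟩
    | .inr (.inl (.inl i)) => IsLinearMap.mk' (fun z => -z.fst i)
        ⟨fun _ _ => by simp; ring, fun _ _ => by simp⟩
    | .inr (.inl (.inr i)) => IsLinearMap.mk' (fun z => P.mulAT z.snd i)
        ⟨fun _ _ => by simp [mulAT_add], fun _ _ => by simp [mulAT_smul]⟩
    | .inr (.inr _) => IsLinearMap.mk' (fun z => inner ℝ P.c z.fst - inner ℝ P.b z.snd)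
        ⟨fun _ _ => by simp [inner_add_right]; ring,
          fun _ _ => by simp [inner_smul_right]; ring⟩
  let h : (Fin m ⊕ Fin m) ⊕ (Fin n ⊕ Fin n) ⊕ Unit → ℝ := fun i =>
    match i with
    | .inl (.inl i) => P.b i
    | .inl (.inr i) => -P.b i
    | .inr (.inl (.inl _)) => 0
    | .inr (.inl (.inr i)) => P.c i
    | .inr (.inr _) => 0
  have hS : P.optSet = {z | ∀ i, g i z ≤ h i} := by
    ext z
    rw [mem_optSet_iff]
    simp only [Set.mem_ofPred_eq, Sum.forall, g, h, IsLinearMap.mk'_apply, neg_le_neg_iff,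
      Left.neg_nonpos_iff, sub_nonpos, forall_const]
    constructor
    · rintro ⟨h1, h2, h3, h4⟩
      exact ⟨⟨fun i => by rw [h1], fun i => by rw [h1]⟩, ⟨h2, h3⟩, h4⟩
    · rintro ⟨⟨h1, h1'⟩, ⟨h2, h3⟩, h4⟩
      exact ⟨by ext i; exact le_antisymm (h1 i) (h1' i), h2, h3, h4⟩
  obtain ⟨C, hC, hdist⟩ := exists_infDist_le_mul_sum_violation g h (hS ▸ hopt)
  have hviol : ∀ z i, max (g i z - h i) 0 ≤ P.kkt z := by
    intro z i
    have k0 : ∀ a b c d : ℝ, a ≤ √(a ^ 2 + b ^ 2 + c ^ 2 + d ^ 2) ∧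
        b ≤ √(a ^ 2 + b ^ 2 + c ^ 2 + d ^ 2) ∧ c ≤ √(a ^ 2 + b ^ 2 + c ^ 2 + d ^ 2) ∧
        d ≤ √(a ^ 2 + b ^ 2 + c ^ 2 + d ^ 2) := fun a b c d => by
      refine ⟨?_, ?_, ?_, ?_⟩ <;> apply Real.le_sqrt_of_sq_le <;>
        linarith only [sq_nonneg a, sq_nonneg b, sq_nonneg c, sq_nonneg d]
    obtain ⟨k1, k2, k3, k4⟩ := k0 ‖P.mulA z.fst - P.b‖ ‖vecPos (-z.fst)‖
      ‖vecPos (P.mulAT z.snd - P.c)‖ (max (inner ℝ P.c z.fst - inner ℝ P.b z.snd) 0)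
    change _ ≤ P.kkt z at k1 k2 k3 k4
    rcases i with (i | i) | (i | i) | i
    · have h1 := abs_apply_le_norm (P.mulA z.fst - P.b) i
      exact max_le (((le_abs_self _).trans h1).trans k1) (kkt_nonneg P z)
    · have h1 := abs_apply_le_norm (P.mulA z.fst - P.b) i
      refine max_le (((neg_le_abs _).trans h1).trans k1 |>.trans' (le_of_eq ?_)) (kkt_nonneg P z)
      change -P.mulA z.fst i - -P.b i = -(P.mulA z.fst i - P.b i)
      ring
    · have h1 := abs_apply_le_norm (vecPos (-z.fst)) i
      refine (((le_abs_self _).trans h1).trans k2).trans' (le_of_eq ?_)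
      change max (-z.fst i - 0) 0 = max (-z.fst i) 0
      rw [sub_zero]
    · have h1 := abs_apply_le_norm (vecPos (P.mulAT z.snd - P.c)) i
      exact ((le_abs_self _).trans h1).trans k3
    · refine k4.trans' (le_of_eq ?_)
      change max (inner ℝ P.c z.fst - inner ℝ P.b z.snd - 0) 0 = _
      rw [sub_zero]
  set q : ℝ := (Fintype.card ((Fin m ⊕ Fin m) ⊕ (Fin n ⊕ Fin n) ⊕ Unit) : ℝ) with hq
  have hq0 : 0 < q := by rw [hq]; exact_mod_cast Fintype.card_pos
  refine ⟨1 / (C * q), by positivity, fun z => ?_⟩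
  rw [hS, one_div, ← div_eq_inv_mul, div_le_iff₀ (by positivity)]
  calc _ ≤ C * ∑ i, max (g i z - h i) 0 := hdist z
    _ ≤ C * ∑ _i, P.kkt z := by gcongr with i; exact hviol z i
    _ = P.kkt z * (C * q) := by
      rw [Finset.sum_const, Finset.card_univ, nsmul_eq_mul]; ring

end StdLP

/-! ### The metric of PDHG -/

namespace StdLP

variable {m n : ℕ}

/-- The operator `P_s = [[I, s Aᵀ], [s A, I]]` of the norm `psNorm`. -/
noncomputable def psOp (P : StdLP m n) (s : ℝ) : PDPair m n →ₗ[ℝ] PDPair m n where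
  toFun v := mkPair (v.fst + s • P.mulAT v.snd) (s • P.mulA v.fst + v.snd)
  map_add' v w := by
    apply WithLp.ofLp_injective
    refine Prod.ext ?_ ?_
    · simp only [mkPair, WithLp.add_fst, WithLp.add_snd, mulAT_add, smul_add, WithLp.ofLp_add,
        Prod.fst_add]
      abel
    · simp only [mkPair, WithLp.add_fst, WithLp.add_snd, mulA_add, smul_add, WithLp.ofLp_add,
        Prod.snd_add]
      abel
  map_smul' t v := by
    apply WithLp.ofLp_injective
    refine Prod.ext ?_ ?_
    · simp only [mkPair, WithLp.smul_fst, WithLp.smul_snd, mulAT_smul, smul_add, WithLp.ofLp_smul,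
        Prod.smul_fst, RingHom.id_apply, smul_comm s t]
    · simp only [mkPair, WithLp.smul_fst, WithLp.smul_snd, mulA_smul, smul_add, WithLp.ofLp_smul,
        Prod.smul_snd, RingHom.id_apply, smul_comm s t]

theorem psOp_fst (P : StdLP m n) (s : ℝ) (v : PDPair m n) :
    (P.psOp s v).fst = v.fst + s • P.mulAT v.snd := rfl

theorem psOp_snd (P : StdLP m n) (s : ℝ) (v : PDPair m n) :
    (P.psOp s v).snd = s • P.mulA v.fst + v.snd := rfl

theorem psNorm_eq (P : StdLP m n) (s : ℝ) (v : PDPair m n) :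
    P.psNorm s v = √(inner ℝ v (P.psOp s v)) := rfl

theorem inner_psOp_comm (P : StdLP m n) (s : ℝ) (v w : PDPair m n) :
    inner ℝ v (P.psOp s w) = inner ℝ w (P.psOp s v) := by
  simp only [inner_pair, psOp_fst, psOp_snd, inner_add_right, real_inner_smul_right,
    ← inner_mulA]
  rw [real_inner_comm w.fst v.fst, real_inner_comm w.snd v.snd,
    real_inner_comm (P.mulA w.fst) v.snd, real_inner_comm (P.mulA v.fst) w.snd]
  ring

/-- For `s ‖A‖ ≤ 1/2` the operator `P_s` is within half the norm of the identity. -/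
theorem norm_psOp_sub_self_le (P : StdLP m n) {s : ℝ} (hs : 0 ≤ s) (hsA : s * ‖P.A‖ ≤ 1 / 2)
    (v : PDPair m n) : ‖P.psOp s v - v‖ ≤ 1 / 2 * ‖v‖ := by
  refine abs_le_of_sq_le_sq' ?_ (by positivity) |>.2
  have h1 : (P.psOp s v - v).fst = s • P.mulAT v.snd := by
    rw [WithLp.sub_fst, psOp_fst, add_sub_cancel_left]
  have h2 : (P.psOp s v - v).snd = s • P.mulA v.fst := by
    rw [WithLp.sub_snd, psOp_snd, add_sub_cancel_right]
  rw [norm_sq_pair, h1, h2, norm_smul, norm_smul, Real.norm_of_nonneg hs, mul_pow (1 / 2),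
    norm_sq_pair v]
  have h3 : s * ‖P.mulAT v.snd‖ ≤ 1 / 2 * ‖v.snd‖ := by
    nlinarith [mul_le_mul_of_nonneg_left (P.norm_mulAT_le v.snd) hs, norm_nonneg v.snd]
  have h4 : s * ‖P.mulA v.fst‖ ≤ 1 / 2 * ‖v.fst‖ := by
    nlinarith [mul_le_mul_of_nonneg_left (P.norm_mulA_le v.fst) hs, norm_nonneg v.fst]
  have h5 := pow_le_pow_left₀ (by positivity) h3 2
  have h6 := pow_le_pow_left₀ (by positivity) h4 2
  linarith

theorem norm_psOp_le (P : StdLP m n) {s : ℝ} (hs : 0 ≤ s) (hsA : s * ‖P.A‖ ≤ 1 / 2)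
    (v : PDPair m n) : ‖P.psOp s v‖ ≤ 3 / 2 * ‖v‖ := by
  have h := norm_add_le (P.psOp s v - v) v
  rw [sub_add_cancel] at h
  linarith [P.norm_psOp_sub_self_le hs hsA v]

theorem abs_inner_psOp_sub_le (P : StdLP m n) {s : ℝ} (hs : 0 ≤ s) (hsA : s * ‖P.A‖ ≤ 1 / 2)
    (v : PDPair m n) : |inner ℝ v (P.psOp s v) - ‖v‖ ^ 2| ≤ 1 / 2 * ‖v‖ ^ 2 := by
  rw [← real_inner_self_eq_norm_sq, ← inner_sub_right, real_inner_self_eq_norm_sq]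
  refine (abs_real_inner_le_norm _ _).trans ?_
  nlinarith [P.norm_psOp_sub_self_le hs hsA v, norm_nonneg v]

theorem half_norm_sq_le_inner_psOp (P : StdLP m n) {s : ℝ} (hs : 0 ≤ s)
    (hsA : s * ‖P.A‖ ≤ 1 / 2) (v : PDPair m n) :
    1 / 2 * ‖v‖ ^ 2 ≤ inner ℝ v (P.psOp s v) := by
  linarith [(abs_le.1 (P.abs_inner_psOp_sub_le hs hsA v)).1]

theorem inner_psOp_le (P : StdLP m n) {s : ℝ} (hs : 0 ≤ s)
    (hsA : s * ‖P.A‖ ≤ 1 / 2) (v : PDPair m n) :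
    inner ℝ v (P.psOp s v) ≤ 3 / 2 * ‖v‖ ^ 2 := by
  linarith [(abs_le.1 (P.abs_inner_psOp_sub_le hs hsA v)).2]

theorem inner_psOp_nonneg (P : StdLP m n) {s : ℝ} (hs : 0 ≤ s)
    (hsA : s * ‖P.A‖ ≤ 1 / 2) (v : PDPair m n) : 0 ≤ inner ℝ v (P.psOp s v) :=
  (by positivity : (0 : ℝ) ≤ 1 / 2 * ‖v‖ ^ 2).trans (P.half_norm_sq_le_inner_psOp hs hsA v)

/-- Convexity of `v ↦ ‖v‖²_{P_s}`. -/
theorem inner_psOp_combo_le (P : StdLP m n) {s : ℝ} (hs : 0 ≤ s) (hsA : s * ‖P.A‖ ≤ 1 / 2)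
    {a b : ℝ} (ha : 0 ≤ a) (hb : 0 ≤ b) (hab : a + b = 1) (v w : PDPair m n) :
    inner ℝ (a • v + b • w) (P.psOp s (a • v + b • w)) ≤
      a * inner ℝ v (P.psOp s v) + b * inner ℝ w (P.psOp s w) := by
  have h := mul_nonneg (mul_nonneg ha hb) (P.inner_psOp_nonneg hs hsA (v - w))
  have hc := P.inner_psOp_comm s w v
  simp only [map_add, map_sub, map_smul, inner_add_left, inner_add_right, inner_sub_left,
    inner_sub_right, real_inner_smul_left, real_inner_smul_right, hc] at h ⊢
  obtain rfl : b = 1 - a := by linarith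
  linarith

/-! ### One PDHG step -/

theorem pdhgStep_fst_nonneg (P : StdLP m n) (s : ℝ) (z : PDPair m n) (i : Fin n) :
    0 ≤ (P.pdhgStep s z).fst i :=
  le_max_right _ _

/-- The dual part of the proximal form of a PDHG step. -/
theorem pdhgStep_dual (P : StdLP m n) (s : ℝ) (z : PDPair m n) :
    s • (P.mulA (P.pdhgStep s z).fst - P.b) = -(P.psOp s (P.pdhgStep s z - z)).snd := by
  have h : (P.pdhgStep s z).snd
      = z.snd + s • (P.b - P.mulA ((2 : ℝ) • (P.pdhgStep s z).fst - z.fst)) := rfl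
  rw [psOp_snd, WithLp.sub_fst, WithLp.sub_snd, h]
  simp only [mulA_sub, mulA_smul]
  module

/-- The multiplier of the constraint `x ≥ 0` in the proximal form of the PDHG step `z ↦ z'`,
scaled by `s`. -/
noncomputable def stepMultiplier (P : StdLP m n) (s : ℝ) (z : PDPair m n) :
    EuclideanSpace ℝ (Fin n) :=
  s • (P.c - P.mulAT (P.pdhgStep s z).snd) + (P.psOp s (P.pdhgStep s z - z)).fst

theorem stepMultiplier_eq (P : StdLP m n) (s : ℝ) (z : PDPair m n) :
    P.stepMultiplier s z
      = vecPos (z.fst - s • (P.c - P.mulAT z.snd)) - (z.fst - s • (P.c - P.mulAT z.snd)) := by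
  have h : (P.pdhgStep s z).fst = vecPos (z.fst - s • (P.c - P.mulAT z.snd)) := rfl
  rw [stepMultiplier, psOp_fst, WithLp.sub_fst, WithLp.sub_snd, mulAT_sub, ← h]
  module

theorem stepMultiplier_nonneg (P : StdLP m n) (s : ℝ) (z : PDPair m n) (i : Fin n) :
    0 ≤ P.stepMultiplier s z i := by
  rw [stepMultiplier_eq]
  exact sub_nonneg.2 (le_max_left _ _)

theorem inner_stepMultiplier (P : StdLP m n) (s : ℝ) (z : PDPair m n) :
    inner ℝ (P.pdhgStep s z).fst (P.stepMultiplier s z) = 0 := by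
  rw [stepMultiplier_eq, PiLp.inner_apply]
  refine Finset.sum_eq_zero fun i _ => ?_
  set u := z.fst - s • (P.c - P.mulAT z.snd) with hu
  change (max (u i) 0 - u i) * max (u i) 0 = 0
  rcases le_total (u i) 0 with h | h
  · rw [max_eq_right h, mul_zero]
  · rw [max_eq_left h, sub_self, zero_mul]

/-- Testing the proximal form of a PDHG step against `w`: the skew-symmetric part `yᵀ A x` drops
out at `w = z'`. -/
theorem inner_psOp_step (P : StdLP m n) (s : ℝ) (z w : PDPair m n) :
    inner ℝ w (P.psOp s (P.pdhgStep s z - z)) = inner ℝ w.fst (P.stepMultiplier s z)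
      - s * (inner ℝ P.c w.fst - inner ℝ (P.mulA w.fst) (P.pdhgStep s z).snd
        + inner ℝ (P.mulA (P.pdhgStep s z).fst) w.snd - inner ℝ P.b w.snd) := by
  have h1 : (P.psOp s (P.pdhgStep s z - z)).fst
      = P.stepMultiplier s z - s • (P.c - P.mulAT (P.pdhgStep s z).snd) := by
    rw [stepMultiplier, add_sub_cancel_left]
  have h2 : (P.psOp s (P.pdhgStep s z - z)).snd
      = -(s • (P.mulA (P.pdhgStep s z).fst - P.b)) := by rw [pdhgStep_dual, neg_neg]
  rw [inner_pair, h1, h2]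
  simp only [inner_sub_right, inner_neg_right, real_inner_smul_right]
  rw [real_inner_comm w.fst P.c, real_inner_comm w.snd P.b, ← inner_mulA,
    real_inner_comm w.snd (P.mulA (P.pdhgStep s z).fst)]
  ring

/-- The duality gap of the new iterate is bounded by a difference of squared `P_s`-norms, which
telescopes over an inner loop. -/
theorem gap_pdhgStep_le (P : StdLP m n) {s : ℝ} (hs : 0 ≤ s) (hsA : s * ‖P.A‖ ≤ 1 / 2)
    (z : PDPair m n) :
    2 * s * (inner ℝ P.c (P.pdhgStep s z).fst - inner ℝ P.b (P.pdhgStep s z).snd) ≤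
      inner ℝ z (P.psOp s z) - inner ℝ (P.pdhgStep s z) (P.psOp s (P.pdhgStep s z)) := by
  have h := P.inner_psOp_step s z (P.pdhgStep s z)
  rw [inner_stepMultiplier] at h
  have h2 := P.inner_psOp_nonneg hs hsA (P.pdhgStep s z - z)
  have hc := P.inner_psOp_comm s z (P.pdhgStep s z)
  simp only [map_sub, inner_sub_left, inner_sub_right, hc] at h h2
  linarith

/-- A PDHG step does not increase the `P_s`-distance to any optimal solution. -/
theorem inner_psOp_pdhgStep_sub_le (P : StdLP m n) {s : ℝ} (hs : 0 ≤ s)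
    (hsA : s * ‖P.A‖ ≤ 1 / 2) {zs : PDPair m n} (hzs : zs ∈ P.optSet) (z : PDPair m n) :
    inner ℝ (P.pdhgStep s z - zs) (P.psOp s (P.pdhgStep s z - zs)) ≤
      inner ℝ (z - zs) (P.psOp s (z - zs)) := by
  obtain ⟨hb, hx, hd, hgap⟩ := (P.mem_optSet_iff zs).1 hzs
  have h := P.inner_psOp_step s z (P.pdhgStep s z)
  have h' := P.inner_psOp_step s z zs
  rw [inner_stepMultiplier] at h
  have hw : 0 ≤ inner ℝ zs.fst (P.stepMultiplier s z) :=
    inner_nonneg_of_forall_nonneg hx (P.stepMultiplier_nonneg s z)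
  have hred : 0 ≤ inner ℝ (P.c - P.mulAT zs.snd) (P.pdhgStep s z).fst :=
    inner_nonneg_of_forall_nonneg (fun i => sub_nonneg.2 (hd i)) (P.pdhgStep_fst_nonneg s z)
  rw [inner_sub_left, real_inner_comm (P.pdhgStep s z).fst (P.mulAT zs.snd), ← inner_mulA] at hred
  rw [hb] at h'
  have h2 := P.inner_psOp_nonneg hs hsA (P.pdhgStep s z - z)
  have hc := P.inner_psOp_comm s z (P.pdhgStep s z)
  have hc1 := P.inner_psOp_comm s z zs
  have hc2 := P.inner_psOp_comm s (P.pdhgStep s z) zs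
  simp only [map_sub, inner_sub_left, inner_sub_right, hc, hc1, hc2] at h h' h2 ⊢
  nlinarith [mul_nonneg hs hred, mul_nonneg hs (sub_nonneg.2 hgap)]

/-! ### The inner loop -/

theorem inner_psOp_inner_iter_sub_le (P : StdLP m n) {s : ℝ} (hs : 0 ≤ s)
    (hsA : s * ‖P.A‖ ≤ 1 / 2) {zs : PDPair m n} (hzs : zs ∈ P.optSet) (z : PDPair m n) (k : ℕ) :
    inner ℝ (P.inner_iter s z k - zs) (P.psOp s (P.inner_iter s z k - zs)) ≤
      inner ℝ (z - zs) (P.psOp s (z - zs)) := by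
  induction k with
  | zero => exact le_rfl
  | succ k ih => exact (P.inner_psOp_pdhgStep_sub_le hs hsA hzs _).trans ih

theorem inner_psOp_inner_avg_sub_le (P : StdLP m n) {s : ℝ} (hs : 0 ≤ s)
    (hsA : s * ‖P.A‖ ≤ 1 / 2) {zs : PDPair m n} (hzs : zs ∈ P.optSet) (z : PDPair m n) (k : ℕ) :
    inner ℝ (P.inner_avg s z k - zs) (P.psOp s (P.inner_avg s z k - zs)) ≤
      inner ℝ (z - zs) (P.psOp s (z - zs)) := by
  induction k with
  | zero => exact le_rfl
  | succ k ih =>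
    have hk : (0 : ℝ) < (k : ℝ) + 1 := by positivity
    have hab : (k : ℝ) / ((k : ℝ) + 1) + 1 / ((k : ℝ) + 1) = 1 := by field_simp
    have heq : P.inner_avg s z (k + 1) - zs
        = ((k : ℝ) / ((k : ℝ) + 1)) • (P.inner_avg s z k - zs)
          + ((1 : ℝ) / ((k : ℝ) + 1)) • (P.inner_iter s z (k + 1) - zs) := by
      conv_lhs => rw [← one_smul ℝ zs, ← hab]
      rw [inner_avg]
      module
    rw [heq]
    refine (P.inner_psOp_combo_le hs hsA (by positivity) (by positivity) hab _ _).trans ?_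
    have h2 := P.inner_psOp_inner_iter_sub_le hs hsA hzs z (k + 1)
    calc _ ≤ (k : ℝ) / ((k : ℝ) + 1) * inner ℝ (z - zs) (P.psOp s (z - zs))
          + 1 / ((k : ℝ) + 1) * inner ℝ (z - zs) (P.psOp s (z - zs)) := by gcongr
      _ = _ := by rw [← add_mul, hab, one_mul]

theorem norm_le_of_inner_psOp_sub_le (P : StdLP m n) {s : ℝ} (hs : 0 ≤ s)
    (hsA : s * ‖P.A‖ ≤ 1 / 2) {z w zs : PDPair m n}
    (h : inner ℝ (w - zs) (P.psOp s (w - zs)) ≤ inner ℝ (z - zs) (P.psOp s (z - zs))) :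
    ‖w‖ ≤ √2 * P.psNorm s (z - zs) + ‖zs‖ := by
  have h1 : ‖w - zs‖ ≤ √2 * P.psNorm s (z - zs) := by
    rw [psNorm_eq, ← Real.sqrt_mul (by norm_num)]
    apply Real.le_sqrt_of_sq_le
    linarith [P.half_norm_sq_le_inner_psOp hs hsA (w - zs)]
  have h2 := norm_add_le (w - zs) zs
  rw [sub_add_cancel] at h2
  linarith

/-- `k` times the `k`-th average is the sum of the iterates `z^1, …, z^k`, in recursive form. -/
theorem smul_inner_avg_succ (P : StdLP m n) (s : ℝ) (z : PDPair m n) (k : ℕ) :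
    ((k + 1 : ℕ) : ℝ) • P.inner_avg s z (k + 1)
      = (k : ℝ) • P.inner_avg s z k + P.pdhgStep s (P.inner_iter s z k) := by
  have hk : (k : ℝ) + 1 ≠ 0 := by positivity
  rw [inner_avg, smul_add, smul_smul, smul_smul]
  push_cast
  rw [mul_div_cancel₀ _ hk, mul_one_div_cancel hk, one_smul]
  rfl

theorem inner_avg_dual (P : StdLP m n) (s : ℝ) (z : PDPair m n) (k : ℕ) :
    (s * k) • (P.mulA (P.inner_avg s z k).fst - P.b)
      = (P.psOp s (z - P.inner_iter s z k)).snd := by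
  suffices h : s • (P.mulA ((k : ℝ) • P.inner_avg s z k).fst - (k : ℝ) • P.b)
      = (P.psOp s (z - P.inner_iter s z k)).snd by
    rw [← h, WithLp.smul_fst, mulA_smul]; module
  induction k with
  | zero => simp [inner_iter, mulA]
  | succ k ih =>
    have h1 := P.pdhgStep_dual s (P.inner_iter s z k)
    change s • (P.mulA (P.inner_iter s z (k + 1)).fst - P.b)
      = -(P.psOp s (P.inner_iter s z (k + 1) - P.inner_iter s z k)).snd at h1
    have h2 : z - P.inner_iter s z (k + 1) = (z - P.inner_iter s z k)
        - (P.inner_iter s z (k + 1) - P.inner_iter s z k) := by abel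
    rw [h2, map_sub, WithLp.sub_snd, sub_eq_add_neg _ (WithLp.snd _), ← h1, ← ih,
      smul_inner_avg_succ, WithLp.add_fst, mulA_add]
    change _ = s • (_ - _) + s • (P.mulA (P.pdhgStep s (P.inner_iter s z k)).fst - P.b)
    push_cast
    module

theorem inner_avg_primal (P : StdLP m n) (s : ℝ) (z : PDPair m n) (k : ℕ) (i : Fin n) :
    s * k * (P.mulAT (P.inner_avg s z k).snd i - P.c i)
      ≤ (P.psOp s (P.inner_iter s z k - z)).fst i := by
  suffices h : s * (P.mulAT ((k : ℝ) • P.inner_avg s z k).snd i - k * P.c i)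
      ≤ (P.psOp s (P.inner_iter s z k - z)).fst i by
    refine le_trans (le_of_eq ?_) h
    rw [WithLp.smul_snd, mulAT_smul, PiLp.smul_apply, smul_eq_mul]; ring
  induction k with
  | zero => simp [inner_iter, mulAT]
  | succ k ih =>
    have h1 := P.stepMultiplier_nonneg s (P.inner_iter s z k) i
    rw [stepMultiplier, PiLp.add_apply, PiLp.smul_apply, PiLp.sub_apply, smul_eq_mul] at h1
    have h2 : P.inner_iter s z (k + 1) - z = (P.inner_iter s z k - z)
        + (P.pdhgStep s (P.inner_iter s z k) - P.inner_iter s z k) := by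
      rw [inner_iter]; abel
    rw [h2, map_add, WithLp.add_fst, PiLp.add_apply, smul_inner_avg_succ, WithLp.add_snd,
      mulAT_add, PiLp.add_apply]
    push_cast
    linarith

theorem inner_avg_gap (P : StdLP m n) {s : ℝ} (hs : 0 ≤ s) (hsA : s * ‖P.A‖ ≤ 1 / 2)
    (z : PDPair m n) (k : ℕ) :
    2 * (s * k) * (inner ℝ P.c (P.inner_avg s z k).fst - inner ℝ P.b (P.inner_avg s z k).snd) ≤
      inner ℝ z (P.psOp s z) - inner ℝ (P.inner_iter s z k) (P.psOp s (P.inner_iter s z k)) := by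
  suffices h : 2 * s * (inner ℝ P.c ((k : ℝ) • P.inner_avg s z k).fst
      - inner ℝ P.b ((k : ℝ) • P.inner_avg s z k).snd) ≤
      inner ℝ z (P.psOp s z)
        - inner ℝ (P.inner_iter s z k) (P.psOp s (P.inner_iter s z k)) by
    refine le_trans (le_of_eq ?_) h
    rw [WithLp.smul_snd, WithLp.smul_fst, real_inner_smul_right, real_inner_smul_right]; ring
  induction k with
  | zero => simp [inner_iter]
  | succ k ih =>
    have h1 := P.gap_pdhgStep_le hs hsA (P.inner_iter s z k)
    rw [smul_inner_avg_succ, WithLp.add_fst, WithLp.add_snd, inner_add_right, inner_add_right,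
      inner_iter]
    linarith

theorem inner_avg_fst_nonneg (P : StdLP m n) (s : ℝ) (z : PDPair m n) (k : ℕ) (i : Fin n) :
    0 ≤ (P.inner_avg s z (k + 1)).fst i := by
  suffices h : ∀ k : ℕ, 0 ≤ ((k : ℝ) • P.inner_avg s z k).fst i by
    have := h (k + 1)
    rw [WithLp.smul_fst, PiLp.smul_apply, smul_eq_mul] at this
    exact nonneg_of_mul_nonneg_right this (by positivity)
  intro k
  induction k with
  | zero => simp
  | succ k ih =>
    rw [smul_inner_avg_succ, WithLp.add_fst]
    exact add_nonneg ih (P.pdhgStep_fst_nonneg s _ i)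

/-- The ergodic rate: after `k` steps the KKT error of the average is `O(1 / k)` times the distance
of the starting point to the optimal set. The first three residuals of the average telescope to
`P_s (z^k - z^0) / (s k)`, and its duality gap is at most
`⟨z^0 - z^k, P_s (z^0 + z^k)⟩ / (2 s k)`. -/
theorem kkt_inner_avg_le (P : StdLP m n) (hopt : P.optSet.Nonempty) {s : ℝ} (hs : 0 < s)
    (hsA : s * ‖P.A‖ ≤ 1 / 2) (z : PDPair m n) {k : ℕ} (hk : 1 ≤ k) {R : ℝ} (h0 : ‖z‖ ≤ R)
    (hR : ‖P.inner_iter s z k‖ ≤ R) :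
    P.kkt (P.inner_avg s z k) ≤ 5 * √(1 + R ^ 2) / (s * k) * Metric.infDist z P.optSet := by
  have hk0 : (0 : ℝ) < k := by exact_mod_cast hk
  have hsk : 0 < s * k := by positivity
  set v := P.inner_iter s z k - z with hv
  have h1 : P.kkt (P.inner_avg s z k) ≤ 1 / (s * k) * ‖P.psOp s v‖ * √(1 + R ^ 2) := by
    apply P.kkt_le_of_forall _ (P.psOp s v) ((norm_nonneg z).trans h0) (by positivity)
    · obtain ⟨j, rfl⟩ := Nat.exists_eq_add_of_le' hk
      exact P.inner_avg_fst_nonneg s z j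
    · rw [one_div, ← div_eq_inv_mul, le_div_iff₀ hsk, mul_comm, ← Real.norm_of_nonneg hsk.le,
        ← norm_smul, inner_avg_dual, hv, ← neg_sub z, map_neg, WithLp.neg_snd, norm_neg]
    · intro i
      rw [one_div, ← div_eq_inv_mul, le_div_iff₀ hsk, mul_comm]
      exact P.inner_avg_primal s z k i
    · rw [one_div, ← div_eq_inv_mul, div_mul_eq_mul_div, le_div_iff₀ hsk]
      have h2 := P.inner_avg_gap hs.le hsA z k
      have h3 : inner ℝ z (P.psOp s z)
          - inner ℝ (P.inner_iter s z k) (P.psOp s (P.inner_iter s z k))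
          = -inner ℝ (z + P.inner_iter s z k) (P.psOp s v) := by
        have hc := P.inner_psOp_comm s z (P.inner_iter s z k)
        simp only [hv, map_sub, inner_add_left, inner_sub_right, hc]
        ring
      have h4 := (abs_le.1 (abs_real_inner_le_norm (z + P.inner_iter s z k) (P.psOp s v))).1
      have h5 : ‖z + P.inner_iter s z k‖ ≤ 2 * R := (norm_add_le _ _).trans (by linarith)
      have h6 := mul_le_mul_of_nonneg_right h5 (norm_nonneg (P.psOp s v))
      linarith
  have h2 : ‖P.psOp s v‖ ≤ 5 * Metric.infDist z P.optSet := by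
    rw [← div_le_iff₀' (by norm_num), Metric.le_infDist hopt]
    intro zs hzs
    rw [div_le_iff₀' (by norm_num), dist_eq_norm]
    have h3 := P.inner_psOp_inner_iter_sub_le hs.le hsA hzs z k
    have h4 := P.half_norm_sq_le_inner_psOp hs.le hsA (P.inner_iter s z k - zs)
    have h5 := P.inner_psOp_le hs.le hsA (z - zs)
    -- `‖z^k - z*‖ ≤ √3 ‖z^0 - z*‖`, and `(3 / 2) (√3 + 1) ≤ 5`
    have h6 : ‖P.inner_iter s z k - zs‖ ≤ 9 / 5 * ‖z - zs‖ :=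
      abs_le_of_sq_le_sq' (by nlinarith [sq_nonneg ‖z - zs‖]) (by positivity) |>.2
    have h7 : ‖v‖ ≤ ‖P.inner_iter s z k - zs‖ + ‖z - zs‖ := by
      have : v = (P.inner_iter s z k - zs) - (z - zs) := by rw [hv]; abel
      rw [this]; exact norm_sub_le _ _
    linarith [P.norm_psOp_le hs.le hsA v, norm_nonneg (z - zs)]
  calc _ ≤ _ := h1
    _ ≤ 1 / (s * k) * (5 * Metric.infDist z P.optSet) * √(1 + R ^ 2) := by gcongr
    _ = _ := by ring

end StdLP

/-! ### Sharpness constants are at most `‖A‖` -/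

namespace StdLP

variable {m n : ℕ}

/-- A dual direction `A u` with `u ≥ 0` along which the dual objective does not decrease: `b` itself
if `b ≠ 0`, as `b = A x*`, and a nonzero column of `A` otherwise. -/
theorem exists_nonneg_mulA_ne_zero (P : StdLP m n) (hA : P.A ≠ 0) (hopt : P.optSet.Nonempty) :
    ∃ u : EuclideanSpace ℝ (Fin n), (∀ i, 0 ≤ u i) ∧ P.mulA u ≠ 0 ∧
      0 ≤ inner ℝ P.b (P.mulA u) := by
  by_cases hb : P.b = 0
  · obtain ⟨j, i, hij⟩ : ∃ j i, P.A j i ≠ 0 := by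
      by_contra! h
      exact hA (Matrix.ext h)
    refine ⟨EuclideanSpace.single i 1, fun l => ?_, fun h => hij ?_, by simp [hb]⟩
    · simp only [PiLp.single_apply]; split_ifs <;> norm_num
    · have := congrArg (fun v : EuclideanSpace ℝ (Fin m) => v j) h
      simpa [mulA, Matrix.toLpLin_apply] using this
  · obtain ⟨zs, hzs⟩ := hopt
    obtain ⟨h1, h2, -, -⟩ := (P.mem_optSet_iff zs).1 hzs
    exact ⟨zs.fst, h2, h1 ▸ hb, h1 ▸ real_inner_self_nonneg⟩

/-- From an optimal `z*`, go along `(0, A u)` with `u` as in `exists_nonneg_mulA_ne_zero`. The KKT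
error grows with slope at most `‖A‖ ‖A u‖`, while the distance to `Z*` grows with slope `‖A u‖`
because every dual feasible `y` satisfies `⟨A u, y⟩ = ⟨u, Aᵀ y⟩ ≤ ⟨u, c⟩`. -/
theorem IsSharpnessConst.le_norm {P : StdLP m n} {α : ℝ} (hα : P.IsSharpnessConst α)
    (hA : P.A ≠ 0) (hopt : P.optSet.Nonempty) : α ≤ ‖P.A‖ := by
  obtain ⟨u, hu, hd0, hbd⟩ := P.exists_nonneg_mulA_ne_zero hA hopt
  obtain ⟨zs, hzs⟩ := id hopt
  obtain ⟨hb, hx, hd, hgap⟩ := (P.mem_optSet_iff zs).1 hzs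
  set d := P.mulA u with hdef
  have hdn : 0 < ‖d‖ := norm_pos_iff.2 hd0
  have hbound : ∀ t : ℝ, 0 ≤ t →
      α * (t * ‖d‖ ^ 2 + inner ℝ d zs.snd - inner ℝ u P.c) ≤ t * (‖P.A‖ * ‖d‖ ^ 2) := by
    intro t ht
    set z : PDPair m n := mkPair zs.fst (zs.snd + t • d) with hz
    have hzf : z.fst = zs.fst := rfl
    have hzsd : z.snd = zs.snd + t • d := rfl
    have hk : P.kkt z ≤ t * (‖P.A‖ * ‖d‖) := by
      have h1 := P.kkt_le_of_forall z (R := 0) (t := t) (mkPair (P.mulAT d) 0) le_rfl ht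
        (by rwa [hzf]) (by rw [hzf, hb, sub_self, norm_zero]; positivity)
        (fun i => by
          change P.mulAT z.snd i - P.c i ≤ t * P.mulAT d i
          rw [hzsd, mulAT_add, mulAT_smul, PiLp.add_apply, PiLp.smul_apply, smul_eq_mul]
          linarith [hd i])
        (by rw [hzf, hzsd, inner_add_right, real_inner_smul_right, mul_zero]
            nlinarith)
      have h2 : ‖mkPair (P.mulAT d) (0 : EuclideanSpace ℝ (Fin m))‖ = ‖P.mulAT d‖ := by
        rw [← sq_eq_sq₀ (norm_nonneg _) (norm_nonneg _), norm_sq_pair]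
        simp [mkPair]
      rw [h2] at h1
      simp only [ne_eq, OfNat.ofNat_ne_zero, not_false_eq_true, zero_pow, add_zero, Real.sqrt_one,
        mul_one] at h1
      exact h1.trans (mul_le_mul_of_nonneg_left (P.norm_mulAT_le d) ht)
    have hdist : (t * ‖d‖ ^ 2 + inner ℝ d zs.snd - inner ℝ u P.c) / ‖d‖
        ≤ Metric.infDist z P.optSet := by
      rw [Metric.le_infDist hopt]
      intro w hw
      obtain ⟨-, -, hwd, -⟩ := (P.mem_optSet_iff w).1 hw
      have h1 : 0 ≤ inner ℝ u (P.c - P.mulAT w.snd) :=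
        inner_nonneg_of_forall_nonneg hu fun i => sub_nonneg.2 (hwd i)
      rw [inner_sub_right, ← inner_mulA] at h1
      have h2 := real_inner_le_norm d (z.snd - w.snd)
      have h3 : inner ℝ d (z.snd - w.snd)
          = t * ‖d‖ ^ 2 + inner ℝ d zs.snd - inner ℝ d w.snd := by
        rw [hzsd, inner_sub_right, inner_add_right, real_inner_smul_right,
          real_inner_self_eq_norm_sq]
        ring
      have h4 : ‖z.snd - w.snd‖ ≤ dist z w := by
        rw [dist_eq_norm]; exact norm_snd_le (z - w)
      rw [div_le_iff₀ hdn]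
      nlinarith [mul_le_mul_of_nonneg_left h4 hdn.le]
    have h := (mul_le_mul_of_nonneg_left hdist hα.1.le).trans ((hα.2 z).trans hk)
    rw [← mul_div_assoc, div_le_iff₀ hdn] at h
    linarith
  by_contra! hlt
  set e : ℝ := (α - ‖P.A‖) * ‖d‖ ^ 2 with he
  have he0 : 0 < e := by have := sub_pos.2 hlt; positivity
  set c : ℝ := α * (inner ℝ u P.c - inner ℝ d zs.snd) with hc
  have h := hbound ((|c| + 1) / e) (by positivity)
  have h1 : (|c| + 1) / e * e = |c| + 1 := div_mul_cancel₀ _ he0.ne'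
  have h2 : (|c| + 1) / e * e ≤ c := by rw [he, hc]; linarith
  linarith [le_abs_self c]

/-! ### Restarts -/

/-- An inner loop started from `z` passes the restart test as soon as
`k ≥ 5 √(1 + R²) / (α s β)`. -/
theorem restartTest_of_le (P : StdLP m n) (hopt : P.optSet.Nonempty) {s β α : ℝ} (hs : 0 < s)
    (hsA : s * ‖P.A‖ ≤ 1 / 2) (hβ : 0 < β) (hα : P.IsSharpnessConst α) (z : PDPair m n) {k : ℕ}
    (hk : 1 ≤ k) {R : ℝ} (h0 : ‖z‖ ≤ R) (hR : ‖P.inner_iter s z k‖ ≤ R)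
    (hkR : 5 * √(1 + R ^ 2) / (α * s * β) ≤ k) : P.RestartTest s β z k := by
  refine ⟨hk, ?_⟩
  have hk0 : (0 : ℝ) < k := by exact_mod_cast hk
  have hα0 := hα.1
  rw [div_le_iff₀ (by positivity)] at hkR
  have h1 : 5 * √(1 + R ^ 2) / (s * k) ≤ α * β := by
    rw [div_le_iff₀ (by positivity)]; linarith
  calc _ ≤ 5 * √(1 + R ^ 2) / (s * k) * Metric.infDist z P.optSet :=
        P.kkt_inner_avg_le hopt hs hsA z hk h0 hR
    _ ≤ α * β * Metric.infDist z P.optSet :=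
        mul_le_mul_of_nonneg_right h1 Metric.infDist_nonneg
    _ = β * (α * Metric.infDist z P.optSet) := by ring
    _ ≤ β * P.kkt z := mul_le_mul_of_nonneg_left (hα.2 z) hβ.le

theorem norm_inner_iter_le (P : StdLP m n) {s : ℝ} (hs : 0 ≤ s) (hsA : s * ‖P.A‖ ≤ 1 / 2)
    {zs : PDPair m n} (hzs : zs ∈ P.optSet) (z : PDPair m n) (k : ℕ) :
    ‖P.inner_iter s z k‖ ≤ √2 * P.psNorm s (z - zs) + ‖zs‖ :=
  P.norm_le_of_inner_psOp_sub_le hs hsA (P.inner_psOp_inner_iter_sub_le hs hsA hzs z k)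

theorem exists_restartTest (P : StdLP m n) (hopt : P.optSet.Nonempty) {s β : ℝ} (hs : 0 < s)
    (hsA : s * ‖P.A‖ ≤ 1 / 2) (hβ : 0 < β) (z : PDPair m n) : ∃ k, P.RestartTest s β z k := by
  obtain ⟨α, hα⟩ := P.exists_isSharpnessConst hopt
  obtain ⟨zs, hzs⟩ := id hopt
  set R := √2 * P.psNorm s (z - zs) + ‖zs‖ with hR
  obtain ⟨k, hk⟩ := exists_nat_ge (5 * √(1 + R ^ 2) / (α * s * β))
  exact ⟨k + 1, P.restartTest_of_le hopt hs hsA hβ hα z (Nat.le_add_left 1 k)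
    (P.norm_inner_iter_le hs.le hsA hzs z 0) (P.norm_inner_iter_le hs.le hsA hzs z (k + 1))
    (hk.trans (by push_cast; linarith))⟩

theorem restartTest_restartLength (P : StdLP m n) (hopt : P.optSet.Nonempty) {s β : ℝ}
    (hs : 0 < s) (hsA : s * ‖P.A‖ ≤ 1 / 2) (hβ : 0 < β) (z : PDPair m n) :
    P.RestartTest s β z (P.restartLength s β z) :=
  Nat.sInf_mem (P.exists_restartTest hopt hs hsA hβ z)

theorem inner_psOp_outer_sub_le (P : StdLP m n) {s : ℝ} (hs : 0 ≤ s) (hsA : s * ‖P.A‖ ≤ 1 / 2)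
    (β : ℝ) {zs : PDPair m n} (hzs : zs ∈ P.optSet) (z0 : PDPair m n) (N : ℕ) :
    inner ℝ (P.outer s β z0 N - zs) (P.psOp s (P.outer s β z0 N - zs)) ≤
      inner ℝ (z0 - zs) (P.psOp s (z0 - zs)) := by
  induction N with
  | zero => exact le_rfl
  | succ N ih => exact (P.inner_psOp_inner_avg_sub_le hs hsA hzs _ _).trans ih

theorem norm_iterate_le (P : StdLP m n) {s : ℝ} (hs : 0 ≤ s) (hsA : s * ‖P.A‖ ≤ 1 / 2)
    (β : ℝ) {zs : PDPair m n} (hzs : zs ∈ P.optSet) (z0 : PDPair m n) (N k : ℕ) :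
    ‖P.iterate s β z0 N k‖ ≤ √2 * P.psNorm s (z0 - zs) + ‖zs‖ :=
  P.norm_le_of_inner_psOp_sub_le hs hsA
    ((P.inner_psOp_inner_iter_sub_le hs hsA hzs _ k).trans
      (P.inner_psOp_outer_sub_le hs hsA β hzs z0 N))

theorem kkt_outer_le (P : StdLP m n) (hopt : P.optSet.Nonempty) {s β : ℝ} (hs : 0 < s)
    (hsA : s * ‖P.A‖ ≤ 1 / 2) (hβ : 0 < β) (z0 : PDPair m n) (N : ℕ) :
    P.kkt (P.outer s β z0 N) ≤ β ^ N * P.kkt z0 := by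
  induction N with
  | zero => simp [outer]
  | succ N ih =>
    refine (P.restartTest_restartLength hopt hs hsA hβ (P.outer s β z0 N)).2.trans ?_
    rw [pow_succ', mul_assoc]
    exact mul_le_mul_of_nonneg_left ih hβ.le

theorem infDist_outer_le (P : StdLP m n) (hopt : P.optSet.Nonempty) {s β α : ℝ} (hs : 0 < s)
    (hsA : s * ‖P.A‖ ≤ 1 / 2) (hβ : 0 < β) (hα : P.IsSharpnessConst α) (z0 : PDPair m n) (N : ℕ) :
    Metric.infDist (P.outer s β z0 N) P.optSet ≤ β ^ N * (1 / α) * P.kkt z0 := by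
  have h := (hα.2 (P.outer s β z0 N)).trans (P.kkt_outer_le hopt hs hsA hβ z0 N)
  rw [mul_right_comm, mul_one_div, le_div_iff₀' hα.1]
  exact h

/-- If the restart length `τ` is at least `2`, the failure of the test at `τ - 1 ≥ τ / 2` bounds it;
if `τ = 1`, the claim amounts to `α s ≤ 1/2`, which follows from `α ≤ ‖A‖`. -/
theorem restartLength_le (P : StdLP m n) (hA : P.A ≠ 0) (hopt : P.optSet.Nonempty)
    {s β α : ℝ} (hs : 0 < s) (hsA : s * ‖P.A‖ ≤ 1 / 2) (hβ : 0 < β) (hβ1 : β < 1)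
    (hα : P.IsSharpnessConst α) (z : PDPair m n) {R : ℝ}
    (hR : ∀ k ≤ P.restartLength s β z, ‖P.inner_iter s z k‖ ≤ R) :
    (P.restartLength s β z : ℝ) ≤ 8 * √2 * √(1 + R ^ 2) / (α * s * β) := by
  have hα0 := hα.1
  have hden : 0 < α * s * β := by positivity
  have hsqrt : (10 : ℝ) ≤ 8 * √2 := by
    have : (5 / 4 : ℝ) ≤ √2 := Real.le_sqrt_of_sq_le (by norm_num)
    linarith
  have hten : 10 * √(1 + R ^ 2) / (α * s * β) ≤ 8 * √2 * √(1 + R ^ 2) / (α * s * β) := by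
    gcongr
  refine le_trans ?_ hten
  set τ := P.restartLength s β z with hτ
  rcases Nat.lt_or_ge τ 2 with h | h
  · have h1 : (τ : ℝ) ≤ 1 := by exact_mod_cast Nat.le_of_lt_succ h
    refine h1.trans ?_
    rw [le_div_iff₀ hden, one_mul]
    have h2 : α * s ≤ 1 / 2 :=
      (mul_le_mul_of_nonneg_right (hα.le_norm hA hopt) hs.le).trans (by rwa [mul_comm])
    have h3 : 1 ≤ √(1 + R ^ 2) := Real.one_le_sqrt.2 (by nlinarith [sq_nonneg R])
    have h4 : α * s * β ≤ 1 / 2 * 1 := mul_le_mul h2 hβ1.le hβ.le (by norm_num)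
    linarith
  · obtain ⟨k, hk⟩ : ∃ k, τ = k + 2 := Nat.exists_eq_add_of_le' h
    have h1 : ¬ P.RestartTest s β z (k + 1) := fun ht => by
      have : τ ≤ k + 1 := Nat.sInf_le ht
      omega
    have h2 : ((k + 1 : ℕ) : ℝ) < 5 * √(1 + R ^ 2) / (α * s * β) := by
      by_contra! hle
      exact h1 (P.restartTest_of_le hopt hs hsA hβ hα z (Nat.le_add_left 1 k)
        (hR 0 (Nat.zero_le _)) (hR (k + 1) (by omega)) hle)
    have h3 : 10 * √(1 + R ^ 2) / (α * s * β) = 2 * (5 * √(1 + R ^ 2) / (α * s * β)) := by ring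
    rw [h3, hk]
    push_cast at h2 ⊢
    linarith [(Nat.cast_nonneg k : (0 : ℝ) ≤ k)]

/-- The number of factors `β` that bring `K` below `ε`. For `K = 0` the junk value `log 0 = 0` gives
exponent `0`, as it should. -/
theorem pow_ceil_log_mul_le {β K ε : ℝ} (hβ0 : 0 < β) (hβ1 : β < 1) (hK : 0 ≤ K) (hε : 0 < ε) :
    β ^ ⌈Real.log (K / ε) / Real.log (1 / β)⌉₊ * K ≤ ε := by
  rcases hK.eq_or_lt with rfl | hK
  · simpa using hε.le
  have hlog : 0 < Real.log (1 / β) := Real.log_pos ((one_lt_div hβ0).2 hβ1)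
  set N := ⌈Real.log (K / ε) / Real.log (1 / β)⌉₊ with hN
  have h1 : Real.log (K / ε) ≤ N * Real.log (1 / β) := (div_le_iff₀ hlog).1 (Nat.le_ceil _)
  rw [← Real.log_pow, Real.log_le_log_iff (by positivity) (by positivity), one_div, inv_pow,
    div_le_iff₀ hε, ← div_eq_inv_mul, le_div_iff₀' (by positivity)] at h1
  exact h1

end StdLP

/-! ### Convergence and complexity of restarted PDHG -/

theorem mainTheorem1 {m n : ℕ} (P : StdLP m n) (hA : P.A ≠ 0) (hopt : P.optSet.Nonempty)
    (s : ℝ) (hs : 0 < s) (hsA : s ≤ 1 / (2 * ‖P.A‖))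
    (β : ℝ) (hβ0 : 0 < β) (hβ1 : β < 1) (z0 : PDPair m n) :
    -- every inner loop terminates, so that the algorithm is well defined
    (∀ N : ℕ, ∃ k : ℕ, P.RestartTest s β (P.outer s β z0 N) k) ∧
    -- (i) the iterates are bounded
    (∃ R : ℝ, 0 < R ∧ ∀ N k : ℕ, ‖P.iterate s β z0 N k‖ ≤ R) ∧
    (∀ zs ∈ P.optSet, ∀ N k : ℕ,
      ‖P.iterate s β z0 N k‖ ≤ Real.sqrt 2 * P.psNorm s (z0 - zs) + ‖zs‖) ∧
    -- a sharpness constant of the KKT error exists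
    (∃ α : ℝ, P.IsSharpnessConst α) ∧
    (∀ α : ℝ, P.IsSharpnessConst α →
      -- (ii) the restart lengths, for any bound R on the iterates
      (∀ R : ℝ, (∀ N k : ℕ, k ≤ P.tau s β z0 N → ‖P.iterate s β z0 N k‖ ≤ R) →
        ∀ N : ℕ, (P.tau s β z0 N : ℝ) ≤
          8 * Real.sqrt 2 * Real.sqrt (1 + R ^ 2) / (α * s * β)) ∧
      -- (iii) linear decay of the distance to the optimal set
      (∀ N : ℕ, Metric.infDist (P.iterate s β z0 N 0) P.optSet ≤ β ^ N * (1 / α) * P.kkt z0) ∧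
      -- the total number of PDHG steps that reach accuracy ε, for the step size s = C / ‖A‖
      (∀ R : ℝ, (∀ N k : ℕ, k ≤ P.tau s β z0 N → ‖P.iterate s β z0 N k‖ ≤ R) →
        ∀ C : ℝ, s = C / ‖P.A‖ → ∀ ε : ℝ, 0 < ε →
          (∃ N : ℕ, Metric.infDist (P.iterate s β z0 N 0) P.optSet ≤ ε ∧
            ((∑ j ∈ Finset.range N, P.tau s β z0 j : ℕ) : ℝ) ≤
              8 * Real.sqrt 2 * Real.sqrt (1 + R ^ 2) / (C * β) * (‖P.A‖ / α) *
                (⌈Real.log (P.kkt z0 / (α * ε)) / Real.log (1 / β)⌉₊ : ℝ)) ∧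
          (∃ N : ℕ, P.kkt (P.iterate s β z0 N 0) ≤ ε ∧
            ((∑ j ∈ Finset.range N, P.tau s β z0 j : ℕ) : ℝ) ≤
              8 * Real.sqrt 2 * Real.sqrt (1 + R ^ 2) / (C * β) * (‖P.A‖ / α) *
                (⌈Real.log (P.kkt z0 / ε) / Real.log (1 / β)⌉₊ : ℝ)))) := by
  have hAn : 0 < ‖P.A‖ := norm_pos_iff.2 hA
  have hsA' : s * ‖P.A‖ ≤ 1 / 2 := by
    rw [le_div_iff₀ (by positivity)] at hsA
    linarith
  have hτ : ∀ α, P.IsSharpnessConst α → ∀ R : ℝ,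
      (∀ N k : ℕ, k ≤ P.tau s β z0 N → ‖P.iterate s β z0 N k‖ ≤ R) →
      ∀ N : ℕ, (P.tau s β z0 N : ℝ) ≤ 8 * √2 * √(1 + R ^ 2) / (α * s * β) :=
    fun α hα R hR N => P.restartLength_le hA hopt hs hsA' hβ0 hβ1 hα _ (hR N)
  refine ⟨fun N => P.exists_restartTest hopt hs hsA' hβ0 _, ?_,
    fun zs hzs => P.norm_iterate_le hs.le hsA' β hzs z0, P.exists_isSharpnessConst hopt,
    fun α hα => ⟨hτ α hα, P.infDist_outer_le hopt hs hsA' hβ0 hα z0, ?_⟩⟩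
  · obtain ⟨zs, hzs⟩ := hopt
    refine ⟨√2 * P.psNorm s (z0 - zs) + ‖zs‖ + 1, ?_, fun N k =>
      (P.norm_iterate_le hs.le hsA' β hzs z0 N k).trans (by linarith)⟩
    have : 0 ≤ P.psNorm s (z0 - zs) := Real.sqrt_nonneg _
    positivity
  · intro R hR C hC ε hε
    have hα0 := hα.1
    have hC' : C = s * ‖P.A‖ := by rw [hC, div_mul_cancel₀ _ hAn.ne']
    have hsum : ∀ N : ℕ, ((∑ j ∈ Finset.range N, P.tau s β z0 j : ℕ) : ℝ) ≤
        8 * √2 * √(1 + R ^ 2) / (C * β) * (‖P.A‖ / α) * (N : ℝ) := by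
      intro N
      have heq : 8 * √2 * √(1 + R ^ 2) / (C * β) * (‖P.A‖ / α)
          = 8 * √2 * √(1 + R ^ 2) / (α * s * β) := by
        rw [hC']; field_simp
      rw [heq, Nat.cast_sum]
      refine (Finset.sum_le_card_nsmul _ _ _ fun j _ => hτ α hα R hR j).trans (le_of_eq ?_)
      rw [Finset.card_range, nsmul_eq_mul, mul_comm]
    refine ⟨⟨_, ?_, hsum _⟩, ⟨_, ?_, hsum _⟩⟩
    · refine (P.infDist_outer_le hopt hs hsA' hβ0 hα z0 _).trans ?_
      rw [mul_right_comm, mul_one_div, div_le_iff₀' hα0]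
      exact StdLP.pow_ceil_log_mul_le hβ0 hβ1 (P.kkt_nonneg z0) (by positivity)
    · exact (P.kkt_outer_le hopt hs hsA' hβ0 z0 _).trans
        (StdLP.pow_ceil_log_mul_le hβ0 hβ1 (P.kkt_nonneg z0) hε)
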